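/- Let $G=(V,E)$ be a finite simple directed planar graph (no loops, no two arcs with the same tail and the same head; antiparallel arcs are allowed) with a fixed planar embedding, given combinatorially by the clockwise cyclic order of the incident arcs around each vertex. Let $s\neq t$ be vertices of $G$, the source and the sink, such that no arc enters $s$ and no arc leaves $t$. Every arc $e$ has a capacity $c(e)\in[0,\infty]$, every vertex $v\in V\setminus\{s,t\}$ has a capacity $c(v)\in[0,\infty]$, and $c(s)=c(t)=\infty$. A function $f:E\to\mathbb R$ is a flow function in $G$ if $0\le f(e)\le c(e)$ for every $e\in E$ and, for every $v\in V\setminus\{s,t\}$, $$\sum_{e\in \mathrm{in}(v)}f(e)\le c(v),\qquad \sum_{e\in \mathrm{in}(v)}f(e)=\sum_{e\in \mathrm{out}(v)}f(e),$$ where $\mathrm{in}(v)$ and $\mathrm{out}(v)$ are the sets of arcs that enter and leave $v$. A function on $E$ is acyclic if there is no directed cycle on all of whose arcs it is positive. The extended graph $G_e$ is obtained from $G$ by replacing each vertex $v$ of finite capacity, of degree $d=|\mathrm{in}(v)|+|\mathrm{out}(v)|$, with $d$ vertices $v_0,\dots,v_{d-1}$; each arc incident to $v$ is attached to a different $v_i$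 instead, preserving the clockwise order, and for every $i$ the vertices $v_i$ and $v_{(i+1)\bmod d}$ are joined by an undirected edge of capacity $c(v)/2$, that is, by two antiparallel arcs of capacity $c(v)/2$ each. The arcs of $G$ keep their capacities and are identified with the corresponding arcs of $G_e$, the source and the sink are still $s$ and $t$, and $G_e$ has no vertex capacities (all of them are $\infty$). Let $f$ be a flow function in $G_e$, and let $\hat f$ be its restriction to the arcs of $G$. If $\hat f$ is acyclic, then $\hat f$ is a flow function in $G$; in particular it satisfies the vertex capacity constraints of $G$. Moreover, around each vertex $v$ of $G$, in the cyclic order of the incident arcs on which $\hat f$ is positive, the arcs that enter $v$ are consecutive and the arcs that leave $v$ are consecutive. -/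

import Mathlib

/-- A flow network: a directed graph with vertices `V` and arcs `E`, a source without incoming arcs,
a sink without outgoing arcs, and capacities in `[0, ∞]` on the arcs and on the vertices.
The source and the sink have no capacity, that is, capacity `∞`.
Parallel arcs and loops are excluded only by `FlowNetwork.IsSimple`. -/
structure FlowNetwork (V E : Type*) where
  tail : E → V
  head : E → V
  source : V
  sink : V
  source_ne_sink : source ≠ sink
  head_ne_source : ∀ e, head e ≠ source
  tail_ne_sink : ∀ e, tail e ≠ sink
  arcCap : E → ENNReal
  vertexCap : V → ENNReal
  vertexCap_source : vertexCap source = ⊤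
  vertexCap_sink : vertexCap sink = ⊤

namespace FlowNetwork

variable {V E : Type*}

/-- No loops and no two arcs with the same tail and the same head
(antiparallel arcs `(u, v)`, `(v, u)` are allowed). -/
def IsSimple (G : FlowNetwork V E) : Prop :=
  (∀ e, G.tail e ≠ G.head e) ∧
    ∀ e e', G.tail e = G.tail e' → G.head e = G.head e' → e = e'

open Classical in
/-- The sum of `f` over the arcs that enter `v`. -/
noncomputable def inflow [Fintype E] (G : FlowNetwork V E) (f : E → ℝ) (v : V) : ℝ :=
  ∑ e ∈ Finset.univ.filter (fun e => G.head e = v), f e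

open Classical in
/-- The sum of `f` over the arcs that leave `v`. -/
noncomputable def outflow [Fintype E] (G : FlowNetwork V E) (f : E → ℝ) (v : V) : ℝ :=
  ∑ e ∈ Finset.univ.filter (fun e => G.tail e = v), f e

/-- Flow functions: arc capacity, vertex capacity and flow conservation constraints. -/
structure IsFlow [Fintype E] (G : FlowNetwork V E) (f : E → ℝ) : Prop where
  nonneg : ∀ e, 0 ≤ f e
  le_arcCap : ∀ e, ENNReal.ofReal (f e) ≤ G.arcCap e
  le_vertexCap : ∀ v, v ≠ G.source → v ≠ G.sink →
    ENNReal.ofReal (G.inflow f v) ≤ G.vertexCap v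
  conservation : ∀ v, v ≠ G.source → v ≠ G.sink → G.inflow f v = G.outflow f v

/-- A cycle: a nonempty sequence of arcs, each starting where its predecessor ends, the first one
starting where the last one ends. -/
def IsCycle (G : FlowNetwork V E) (l : List E) : Prop :=
  l.IsChain (fun e e' => G.head e = G.tail e') ∧
    ∃ h : l ≠ [], G.head (l.getLast h) = G.tail (l.head h)

/-- `f` has no flow-cycle, that is, no cycle all of whose arcs have positive `f`-value. -/
def IsAcyclic (G : FlowNetwork V E) (f : E → ℝ) : Prop :=
  ¬ ∃ l : List E, G.IsCycle l ∧ ∀ e ∈ l, 0 < f e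

/-- The vertex at which a dart (an end of an arc) lies: `(e, false)` is the end of `e` at its tail,
`(e, true)` is the end of `e` at its head. -/
def dartVertex (G : FlowNetwork V E) (d : E × Bool) : V :=
  if d.2 then G.head d.1 else G.tail d.1

end FlowNetwork

/-- The permutation of the darts that exchanges the two ends of every arc. -/
def dartFlip (E : Type*) : Equiv.Perm (E × Bool) :=
  Equiv.prodCongr (Equiv.refl E) Equiv.boolNot

/-- The number of cycles of a permutation, fixed points included. -/
noncomputable def numCycles {D : Type*} (p : Equiv.Perm D) : ℕ :=
  Nat.card (Quotient (Equiv.Perm.SameCycle.setoid p))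

/-- A combinatorial planar embedding of the underlying graph, given by a rotation system:
`rot` sends each dart to the next one in the clockwise order around its vertex.
The faces are the cycles of `rot * dartFlip E`, the connected components (those with at least one
arc) are the orbits of the group generated by `rot` and `dartFlip E`, and the vertices that are not
isolated are the cycles of `rot`. Planarity is Euler's formula `|V| - |E| + |F| = 2 |C|`; since
every connected component satisfies `|V| - |E| + |F| ≤ 2`, it says that every component is
embedded in the sphere. Isolated vertices play no role. -/
structure PlanarEmbedding {V E : Type*} [Fintype E] (G : FlowNetwork V E) where
  rot : Equiv.Perm (E × Bool)
  sameCycle_iff : ∀ d d', rot.SameCycle d d' ↔ G.dartVertex d = G.dartVertex d'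
  euler : numCycles rot + numCycles (rot * dartFlip E) =
    Fintype.card E +
      2 * Nat.card (MulAction.orbitRel.Quotient
        (Subgroup.closure ({rot, dartFlip E} : Set (Equiv.Perm (E × Bool)))) (E × Bool))

namespace PlanarEmbedding

variable {V E : Type*} {G : FlowNetwork V E}

theorem dartVertex_rot [Fintype E] (emb : PlanarEmbedding G) (d : E × Bool) :
    G.dartVertex (emb.rot d) = G.dartVertex d :=
  ((emb.sameCycle_iff d (emb.rot d)).1 ⟨1, by simp⟩).symm

/-- The darts at capacitated vertices, that is, vertices of finite capacity. -/
abbrev CapDart (G : FlowNetwork V E) : Type _ :=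
  {d : E × Bool // G.vertexCap (G.dartVertex d) ≠ ⊤}

/-- The vertices of the extended graph: the vertices of infinite capacity, and for each vertex `v`
of finite capacity one vertex for each dart at `v`. -/
abbrev ExtVertex (G : FlowNetwork V E) : Type _ :=
  {v : V // G.vertexCap v = ⊤} ⊕ CapDart G

/-- The arcs of the extended graph: the arcs of `G`, and for each dart `d` at a vertex of finite
capacity an undirected edge between `d` and the clockwise next dart, as two antiparallel arcs. -/
abbrev ExtArc (G : FlowNetwork V E) : Type _ :=
  E ⊕ (CapDart G × Bool)

/-- The clockwise successor on the cycle `C_v` that replaces a vertex `v` of finite capacity. -/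
def next [Fintype E] (emb : PlanarEmbedding G) (d : CapDart G) : CapDart G :=
  ⟨emb.rot d.1, by rw [emb.dartVertex_rot]; exact d.2⟩

open Classical in
/-- The vertex of the extended graph to which a dart of `G` is attached. -/
noncomputable def attach (G : FlowNetwork V E) (d : E × Bool) : ExtVertex G :=
  if h : G.vertexCap (G.dartVertex d) = ⊤ then Sum.inl ⟨G.dartVertex d, h⟩ else Sum.inr ⟨d, h⟩

open Classical in
noncomputable instance instFintypeCapDart [Fintype E] (G : FlowNetwork V E) : Fintype (CapDart G) :=
  Fintype.ofFinite _

theorem attach_eq_inl {d : E × Bool} {v : {v : V // G.vertexCap v = ⊤}}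
    (h : attach G d = Sum.inl v) : G.dartVertex d = v.1 := by
  unfold attach at h
  split at h
  · exact congrArg Subtype.val (Sum.inl.inj h)
  · cases h

/-- The extended graph: each vertex `v` of finite capacity is replaced by a cycle of undirected
edges of capacity `c(v) / 2` through one new vertex for each arc incident to `v`, in the clockwise
order of these arcs. There are no vertex capacities. -/
noncomputable def extended [Fintype E] (emb : PlanarEmbedding G) : FlowNetwork (ExtVertex G) (ExtArc G) where
  tail
    | Sum.inl e => attach G (e, false)
    | Sum.inr (d, false) => Sum.inr d
    | Sum.inr (d, true) => Sum.inr (emb.next d)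
  head
    | Sum.inl e => attach G (e, true)
    | Sum.inr (d, false) => Sum.inr (emb.next d)
    | Sum.inr (d, true) => Sum.inr d
  source := Sum.inl ⟨G.source, G.vertexCap_source⟩
  sink := Sum.inl ⟨G.sink, G.vertexCap_sink⟩
  source_ne_sink := fun h => G.source_ne_sink (congrArg Subtype.val (Sum.inl.inj h))
  head_ne_source := by
    rintro (e | ⟨d, _ | _⟩) h
    · exact G.head_ne_source e (attach_eq_inl h)
    · cases h
    · cases h
  tail_ne_sink := by
    rintro (e | ⟨d, _ | _⟩) h
    · exact G.tail_ne_sink e (attach_eq_inl h)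
    · cases h
    · cases h
  arcCap
    | Sum.inl e => G.arcCap e
    | Sum.inr (d, _) => G.vertexCap (G.dartVertex d.1) / 2
  vertexCap := fun _ => ⊤
  vertexCap_source := rfl
  vertexCap_sink := rfl

/-- The restriction of a function on the arcs of the extended graph to the arcs of `G`. -/
def restrict (f : ExtArc G → ℝ) : E → ℝ := fun e => f (Sum.inl e)

/-- The darts at `v`, listed once each in clockwise order from a suitable first dart, split into two
blocks `l₁`, `l₂` such that every arc with positive `f`-value into `v` is in `l₁` and every arc
with positive `f`-value out of `v` is in `l₂`. Thus, in the cyclic order of the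
arcs incident to `v` with positive value, the incoming ones are consecutive and so are the outgoing
ones. -/
def ConsecutiveAt [Fintype E] (emb : PlanarEmbedding G) (f : E → ℝ) (v : V) : Prop :=
  ∃ l₁ l₂ : List (E × Bool),
    (l₁ ++ l₂).Nodup ∧ (∀ d, d ∈ l₁ ++ l₂ ↔ G.dartVertex d = v) ∧
      (l₁ ++ l₂).IsChain (fun d d' => d' = emb.rot d) ∧
      (∀ e, G.head e = v → 0 < f e → (e, true) ∈ l₁) ∧
      ∀ e, G.tail e = v → 0 < f e → (e, false) ∈ l₂

end PlanarEmbedding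

/-!
Label the end of an arc at its head incoming and the one at its tail outgoing, and call a dart an
ascent of a permutation if it is outgoing and the next dart is incoming. Cut the ends of the arcs
without flow out of the rotation; this does not increase the genus. In what remains, every vertex
other than the source and the sink has an ascent, by conservation, and so has every face, because
its boundary would otherwise be a flow-cycle. There are as many ascents at the vertices and on the
faces together as there are arcs, so Euler's formula leaves room for only one ascent at each vertex,
which means that the arcs that enter the vertex are consecutive. In the extended graph the flow into
such a block of arcs can leave it only through the two ring edges at its ends, each of capacity
`c(v) / 2`.
-/

section Cycles

open Equiv Equiv.Perm

variable {D : Type*}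

theorem orbitRel_closure_le_iff {M : Type*} [Group M] [MulAction M D] {s : Set M} {r : Setoid D} :
    MulAction.orbitRel (Subgroup.closure s) D ≤ r ↔ ∀ g ∈ s, ∀ x, r (g • x) x := by
  refine ⟨fun h g hg x => h ⟨⟨g, Subgroup.subset_closure hg⟩, rfl⟩, fun h => ?_⟩
  suffices ∀ g ∈ Subgroup.closure s, ∀ x, r (g • x) x by
    rintro _ x ⟨g, rfl⟩
    exact this g g.2 x
  intro g hg
  induction hg using Subgroup.closure_induction with
  | mem g hg => exact h g hg
  | one => exact fun x => (one_smul M x).symm ▸ r.refl x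
  | mul g k _ _ ihg ihk => exact fun x => mul_smul g k x ▸ r.trans (ihg (k • x)) (ihk x)
  | inv g _ ih => exact fun x => r.symm (by simpa only [smul_inv_smul] using ih (g⁻¹ • x))

theorem sameCycle_setoid_eq_orbitRel (p : Perm D) :
    SameCycle.setoid p = MulAction.orbitRel (Subgroup.closure {p}) D := by
  ext x y
  rw [← Subgroup.zpowers_eq_closure]
  refine sameCycle_comm.trans ⟨?_, ?_⟩
  · rintro ⟨i, hi⟩
    exact ⟨⟨p ^ i, i, rfl⟩, hi⟩
  · rintro ⟨⟨_, i, rfl⟩, hi⟩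
    exact ⟨i, hi⟩

theorem sameCycle_setoid_le_iff {p : Perm D} {r : Setoid D} :
    SameCycle.setoid p ≤ r ↔ ∀ x, r (p x) x := by
  simp only [sameCycle_setoid_eq_orbitRel, orbitRel_closure_le_iff, Set.mem_singleton_iff,
    forall_eq, Perm.smul_def]

theorem orbitRel_closure_pair (p q : Perm D) :
    MulAction.orbitRel (Subgroup.closure {p, q}) D = SameCycle.setoid p ⊔ SameCycle.setoid q := by
  refine le_antisymm (orbitRel_closure_le_iff.2 ?_) (sup_le ?_ ?_)
  · rintro g (rfl | rfl) x
    · exact sameCycle_setoid_le_iff.1 le_sup_left x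
    · exact sameCycle_setoid_le_iff.1 le_sup_right x
  · exact sameCycle_setoid_le_iff.2 fun x => ⟨⟨p, Subgroup.subset_closure (by simp)⟩, rfl⟩
  · exact sameCycle_setoid_le_iff.2 fun x => ⟨⟨q, Subgroup.subset_closure (by simp)⟩, rfl⟩

theorem sameCycle_setoid_mul_le (p q : Perm D) :
    SameCycle.setoid (p * q) ≤ SameCycle.setoid p ⊔ SameCycle.setoid q :=
  sameCycle_setoid_le_iff.2 fun x => Setoid.trans' _
    (sameCycle_setoid_le_iff.1 le_sup_left (q x)) (sameCycle_setoid_le_iff.1 le_sup_right x)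

theorem eq_of_sameCycle_of_forall_le_apply {α : Type*} [PartialOrder α] [Finite D] {p : Perm D}
    {g : D → α} {x y : D} (hg : ∀ z, p.SameCycle x z → g z ≤ g (p z)) (hxy : p.SameCycle x y) :
    g y = g x := by
  have hle : ∀ {a b}, p.SameCycle x a → p.SameCycle a b → g a ≤ g b := by
    intro a b ha hab
    obtain ⟨n, rfl⟩ := hab.exists_nat_pow_eq
    induction n with
    | zero => exact le_rfl
    | succ n ih =>
      rw [pow_succ', Perm.mul_apply]
      exact (ih ⟨n, by simp⟩).trans (hg _ (ha.trans ⟨n, by simp⟩))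
  exact (hle hxy hxy.symm).antisymm (hle (.refl _ _) hxy)

end Cycles

section Genus

open Equiv Equiv.Perm

variable {D : Type*}

/-- The number of orbits of the group generated by `p` and `q`, that is, of connected components of
the map whose vertices are the cycles of `p` and whose edges are the cycles of `q`. -/
noncomputable def numOrbits (p q : Perm D) : ℕ :=
  Nat.card (MulAction.orbitRel.Quotient (Subgroup.closure {p, q}) D)

/-- Twice the number of components minus the number of vertices and of faces of the map whose
vertices are the cycles of `p` and whose edges are the cycles of `q`. Euler's formula
`|V| - |E| + |F| = 2 |C|` says that this number is `-|E|`; in general it is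
larger by twice the genus. -/
noncomputable def eulerDefect (p q : Perm D) : ℤ :=
  2 * numOrbits p q - numCycles p - numCycles (p * q)

theorem numOrbits_eq_card_quotient (p q : Perm D) :
    numOrbits p q = Nat.card (Quotient (SameCycle.setoid p ⊔ SameCycle.setoid q)) := by
  rw [numOrbits, MulAction.orbitRel.Quotient, orbitRel_closure_pair]

variable [DecidableEq D] {a b : D}

theorem sup_swap_eq_self {r : Setoid D} (h : r a b) :
    r ⊔ SameCycle.setoid (swap a b) = r := by
  rw [sup_eq_left, sameCycle_setoid_le_iff]
  intro x
  rw [swap_apply_def]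
  split_ifs with hxa hxb
  · exact hxa ▸ r.symm h
  · exact hxb ▸ h
  · exact r.refl x

theorem sup_swap_eq_ker (r : Setoid D) [DecidableEq (Quotient r)] (a b : D) :
    r ⊔ SameCycle.setoid (swap a b) =
      Setoid.ker (Function.update id ⟦b⟧ ⟦a⟧ ∘ Quotient.mk r) := by
  set F : D → Quotient r := Function.update id ⟦b⟧ ⟦a⟧ ∘ Quotient.mk r
  have hF : ∀ x, F x = if (⟦x⟧ : Quotient r) = ⟦b⟧ then ⟦a⟧ else ⟦x⟧ := fun x => by
    simp [F, Function.update_apply]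
  refine le_antisymm (sup_le (fun x y hxy => ?_) (sameCycle_setoid_le_iff.2 fun x => ?_))
    fun x y hxy => ?_
  · exact congrArg (Function.update id ⟦b⟧ ⟦a⟧) (Quotient.sound hxy)
  · rw [Setoid.ker_def, hF, hF, swap_apply_def]
    split_ifs <;> simp_all
  · set m := r ⊔ SameCycle.setoid (swap a b)
    have hab : (⟦a⟧ : Quotient m) = ⟦b⟧ :=
      Quotient.sound ((le_sup_right : _ ≤ m) ⟨1, by simp⟩)
    let descend : Quotient r → Quotient m := Quotient.map id (le_sup_left : r ≤ m)
    have hdescend : ∀ x, descend (F x) = ⟦x⟧ := fun x => by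
      rw [hF]
      split_ifs with hx
      · exact hab.trans (congrArg descend hx).symm
      · rfl
    refine Quotient.exact (s := m) ?_
    rw [← hdescend x, ← hdescend y, Setoid.ker_def.1 hxy]

theorem sameCycle_setoid_swap_mul_sup_swap (a b : D) (p : Perm D) :
    SameCycle.setoid (swap a b * p) ⊔ SameCycle.setoid (swap a b) =
      SameCycle.setoid p ⊔ SameCycle.setoid (swap a b) := by
  have hle : ∀ p : Perm D, SameCycle.setoid (swap a b * p) ⊔ SameCycle.setoid (swap a b) ≤
      SameCycle.setoid p ⊔ SameCycle.setoid (swap a b) := fun p =>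
    sup_le ((sameCycle_setoid_mul_le _ _).trans (sup_comm _ _).le) le_sup_right
  exact (hle p).antisymm (by simpa only [swap_mul_self_mul] using hle (swap a b * p))

variable [Finite D]

theorem card_quotient_eq_card_sup_swap_add_one {r : Setoid D} (h : ¬ r a b) :
    Nat.card (Quotient r) = Nat.card (Quotient (r ⊔ SameCycle.setoid (swap a b))) + 1 := by
  classical
  have hab : (⟦a⟧ : Quotient r) ≠ ⟦b⟧ := fun e => h (Quotient.exact e)
  have hrange : Set.range (Function.update id ⟦b⟧ ⟦a⟧ ∘ Quotient.mk r) = {⟦b⟧}ᶜ := by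
    rw [Set.range_comp, Set.range_quotient_mk, Set.image_univ]
    ext c
    constructor
    · rintro ⟨c, rfl⟩
      rcases eq_or_ne c ⟦b⟧ with rfl | hc
      · simpa using hab
      · simp [hc]
    · exact fun hc => ⟨c, Function.update_of_ne hc _ _⟩
  rw [sup_swap_eq_ker, Nat.card_congr (Setoid.quotientKerEquivRange _), hrange,
    Nat.card_coe_set_eq, ← Set.ncard_compl_add_ncard {⟦b⟧}, Set.ncard_singleton]

theorem card_quotient_le_card_sup_swap_add_one (r : Setoid D) (a b : D) :
    Nat.card (Quotient r) ≤ Nat.card (Quotient (r ⊔ SameCycle.setoid (swap a b))) + 1 := by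
  by_cases h : r a b
  · rw [sup_swap_eq_self h]
    exact Nat.le_succ _
  · exact (card_quotient_eq_card_sup_swap_add_one h).le

theorem sameCycle_swap_mul {p : Perm D} (h : ¬ p.SameCycle a b) :
    (swap a b * p).SameCycle a b := by
  have hpow : ∀ n : ℕ, (swap a b * p).SameCycle a ((p ^ n) a) := by
    intro n
    induction n with
    | zero => exact .refl _ _
    | succ n ih =>
      rw [pow_succ', Perm.mul_apply]
      by_cases hna : p ((p ^ n) a) = a
      · rw [hna]
      · have hnb : p ((p ^ n) a) ≠ b := fun hnb => h ⟨(n + 1 : ℕ), by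
          rw [zpow_natCast, pow_succ', Perm.mul_apply, hnb]⟩
        exact ih.trans ⟨1, by simp [swap_apply_of_ne_of_ne hna hnb]⟩
  obtain ⟨n, hn⟩ := (show p.SameCycle a (p⁻¹ a) from ⟨-1, by simp⟩).exists_nat_pow_eq
  exact (hpow n).trans ⟨1, by simp [hn]⟩

/-- Starting from `a`, the permutation `swap a b * p` follows `p` until just before `b` and then
returns to `a`. -/
theorem not_sameCycle_swap_mul {p : Perm D} (hab : a ≠ b) (h : p.SameCycle a b) :
    ¬ (swap a b * p).SameCycle a b := by
  classical
  let k := Nat.find h.exists_nat_pow_eq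
  have hk : (p ^ k) a = b := Nat.find_spec h.exists_nat_pow_eq
  have hne_b : ∀ i < k, (p ^ i) a ≠ b := fun i => Nat.find_min h.exists_nat_pow_eq
  have hk_pos : 0 < k := Nat.pos_of_ne_zero fun h0 => hab (by simpa [h0] using hk)
  have hne_a : ∀ i, 0 < i → i < k → (p ^ i) a ≠ a := by
    intro i hi hik hia
    refine hne_b (k - i) (by omega) ?_
    rw [← hk, ← congrArg (p ^ (k - i)) hia, ← Perm.mul_apply, ← pow_add, Nat.sub_add_cancel hik.le]
  let segment : Set D := {x | ∃ i < k, (p ^ i) a = x}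
  have hmaps : Set.MapsTo (swap a b * p) segment segment := by
    rintro _ ⟨i, hi, rfl⟩
    have hnext : (swap a b * p) ((p ^ i) a) = swap a b ((p ^ (i + 1)) a) := by
      rw [pow_succ', Perm.mul_apply, Perm.mul_apply]
    rcases (Nat.succ_le_of_lt hi).lt_or_eq with hlt | heq
    · exact ⟨i + 1, hlt, by
        rw [hnext, swap_apply_of_ne_of_ne (hne_a _ i.succ_pos hlt) (hne_b _ hlt)]⟩
    · exact ⟨0, hk_pos, by rw [hnext, show i + 1 = k from heq, hk, swap_apply_right]; rfl⟩
  intro hs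
  obtain ⟨n, hn⟩ := hs.exists_nat_pow_eq
  obtain ⟨i, hi, hib⟩ := hmaps.perm_pow n ⟨0, hk_pos, rfl⟩
  exact hne_b i hi (hib.trans hn)

theorem numCycles_swap_mul_of_sameCycle {p : Perm D} (hab : a ≠ b) (h : p.SameCycle a b) :
    numCycles (swap a b * p) = numCycles p + 1 := by
  rw [numCycles, numCycles, card_quotient_eq_card_sup_swap_add_one
    (r := SameCycle.setoid (swap a b * p)) (not_sameCycle_swap_mul hab h),
    sameCycle_setoid_swap_mul_sup_swap, sup_swap_eq_self (r := SameCycle.setoid p) h]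

theorem numCycles_swap_mul_of_not_sameCycle {p : Perm D} (h : ¬ p.SameCycle a b) :
    numCycles p = numCycles (swap a b * p) + 1 := by
  have hab : a ≠ b := fun hab => h (hab ▸ .refl _ _)
  simpa only [swap_mul_self_mul] using
    numCycles_swap_mul_of_sameCycle hab (sameCycle_swap_mul h)

/-- Splitting a vertex never increases the genus: it adds a vertex, and it either adds a face, which
makes up for a possible new component, or merges two faces and leaves the components alone. -/
theorem eulerDefect_swap_mul_le {p : Perm D} (q : Perm D) (hab : a ≠ b) (h : p.SameCycle a b) :
    eulerDefect (swap a b * p) q ≤ eulerDefect p q := by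
  have hvertices := numCycles_swap_mul_of_sameCycle hab h
  have hsup : SameCycle.setoid (swap a b * p) ⊔ SameCycle.setoid q ⊔ SameCycle.setoid (swap a b) =
      SameCycle.setoid p ⊔ SameCycle.setoid q := by
    rw [sup_right_comm, sameCycle_setoid_swap_mul_sup_swap, sup_right_comm]
    exact sup_swap_eq_self ((le_sup_left : SameCycle.setoid p ≤ _) h)
  unfold eulerDefect
  rw [mul_assoc]
  by_cases hface : (p * q).SameCycle a b
  · have hfaces := numCycles_swap_mul_of_sameCycle hab hface
    have horbits : numOrbits (swap a b * p) q ≤ numOrbits p q + 1 := by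
      rw [numOrbits_eq_card_quotient, numOrbits_eq_card_quotient, ← hsup]
      exact card_quotient_le_card_sup_swap_add_one _ a b
    omega
  · have hfaces := numCycles_swap_mul_of_not_sameCycle hface
    have horbits : numOrbits (swap a b * p) q = numOrbits p q := by
      have hjoin : (SameCycle.setoid (swap a b * p) ⊔ SameCycle.setoid q) a b :=
        sameCycle_setoid_mul_le _ _ (mul_assoc (swap a b) p q ▸ sameCycle_swap_mul hface)
      rw [numOrbits_eq_card_quotient, numOrbits_eq_card_quotient, ← hsup, sup_swap_eq_self hjoin]
    omega

end Genus

section Ascents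

open Equiv Equiv.Perm

variable {D α : Type*}

/-- The elements at which the label `σ` increases when one moves a step along the
permutation `p`. -/
def ascents [LT α] (p : Perm D) (σ : D → α) : Set D :=
  {d | σ d < σ (p d)}

/-- Each cycle of `p` contains at most one ascent of `σ`. For two labels this says that each label
occupies a block of consecutive elements of the cycle. -/
def AtMostOneAscent [LT α] (p : Perm D) (σ : D → α) : Prop :=
  ∀ d ∈ ascents p σ, ∀ d' ∈ ascents p σ, p.SameCycle d d' → d = d'

theorem eq_of_sameCycle_of_forall_notMem_ascents [LinearOrder α] [Finite D] {p : Perm D} {σ : D → α}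
    {x y : D} (h : ∀ z, p.SameCycle x z → z ∉ ascents p σ) (hxy : p.SameCycle x y) : σ y = σ x :=
  eq_of_sameCycle_of_forall_le_apply (α := αᵒᵈ) (fun z hz => not_lt.1 (h z hz)) hxy

section Counting

variable [Finite D] {p q : Perm D}

/-- Both sides count the `d` with `σ (p d) = true`: such a `d` is an ascent of `p` if
`σ d = false`, and the image under `q` of an ascent of `p * q` if `σ d = true`. -/
theorem ncard_ascents_add_ncard_ascents_mul {σ : D → Bool} (hq : ∀ d, σ (q d) = !σ d) :
    (ascents p σ).ncard + (ascents (p * q) σ).ncard = {d | σ d = true}.ncard := by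
  have himage : q '' ascents (p * q) σ = {d | σ d = true ∧ σ (p d) = true} := by
    ext d
    obtain ⟨d, rfl⟩ := q.surjective d
    rw [q.injective.mem_set_image]
    simp [ascents, Bool.lt_iff, hq]
  have hunion : ascents p σ ∪ q '' ascents (p * q) σ = p ⁻¹' {d | σ d = true} := by
    rw [himage]
    ext d
    cases hd : σ d <;> simp [ascents, Bool.lt_iff, hd]
  have hdisjoint : Disjoint (ascents p σ) (q '' ascents (p * q) σ) := by
    rw [himage]
    exact Set.disjoint_left.2 fun d hd hd' => by simp_all [ascents]
  rw [← Set.ncard_image_of_injective (ascents (p * q) σ) q.injective,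
    ← Set.ncard_union_eq hdisjoint, hunion,
    Set.ncard_preimage_of_injective_subset_range p.injective (by simp [p.surjective.range_eq])]

variable [LT α] {σ : D → α}

theorem numCycles_le_ncard_ascents (h : ∀ x, ∃ y ∈ ascents p σ, p.SameCycle x y) :
    numCycles p ≤ (ascents p σ).ncard := by
  have himage : Quotient.mk (SameCycle.setoid p) '' ascents p σ = Set.univ :=
    Set.eq_univ_of_forall <| Quotient.ind fun x =>
      let ⟨y, hy, hxy⟩ := h x
      ⟨y, hy, Quotient.sound hxy.symm⟩
  rw [numCycles, ← Set.ncard_univ, ← himage]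
  exact Set.ncard_image_le

theorem numCycles_le_ncard_image_ascents_add [Finite α]
    (h : ∀ x y, (∀ z, p.SameCycle x z → z ∉ ascents p σ) →
      (∀ z, p.SameCycle y z → z ∉ ascents p σ) → σ x = σ y →
      (SameCycle.setoid p ⊔ SameCycle.setoid q) x y → p.SameCycle x y) :
    numCycles p ≤ (Quotient.mk (SameCycle.setoid p) '' ascents p σ).ncard +
      Nat.card α * numOrbits p q := by
  set ascending := Quotient.mk (SameCycle.setoid p) '' ascents p σ
  have hfree : ∀ c ∈ ascendingᶜ, ∀ z, p.SameCycle c.out z → z ∉ ascents p σ :=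
    fun c hc z hz hzmem => hc ⟨z, hzmem, (Quotient.sound (SameCycle.symm hz)).trans c.out_eq⟩
  have hcompl : ascendingᶜ.ncard ≤ Nat.card α * numOrbits p q := by
    rw [numOrbits_eq_card_quotient, ← Nat.card_prod, ← Set.ncard_univ]
    refine Set.ncard_le_ncard_of_injOn (fun c => (σ c.out, ⟦c.out⟧)) (fun _ _ => Set.mem_univ _) ?_
    intro c hc c' hc' heq
    rw [← c.out_eq, ← c'.out_eq]
    exact Quotient.sound (h _ _ (hfree c hc) (hfree c' hc') (congrArg Prod.fst heq)
      (Quotient.exact (congrArg Prod.snd heq)))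
  rw [numCycles, ← Set.ncard_add_ncard_compl ascending]
  exact Nat.add_le_add_left hcompl _

end Counting

/-- Every face has an ascent, and so has every vertex but two per component. By Euler's formula the
ascents are too few for a vertex to have a second one. -/
theorem atMostOneAscent_of_eulerDefect_add_ncard_nonpos [Finite D] {p q : Perm D} {σ : D → Bool}
    (hq : ∀ d, σ (q d) = !σ d) (hfaces : ∀ x, ∃ y ∈ ascents (p * q) σ, (p * q).SameCycle x y)
    (hvertices : ∀ x y, (∀ z, p.SameCycle x z → z ∉ ascents p σ) →
      (∀ z, p.SameCycle y z → z ∉ ascents p σ) → σ x = σ y →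
      (SameCycle.setoid p ⊔ SameCycle.setoid q) x y → p.SameCycle x y)
    (heuler : eulerDefect p q + {d | σ d = true}.ncard ≤ 0) : AtMostOneAscent p σ := by
  have hcount := ncard_ascents_add_ncard_ascents_mul (p := p) hq
  have hfaces_le := numCycles_le_ncard_ascents hfaces
  have hvertices_le := numCycles_le_ncard_image_ascents_add hvertices
  rw [Nat.card_eq_fintype_card, Fintype.card_bool] at hvertices_le
  have himage_le := Set.ncard_image_le (f := Quotient.mk (SameCycle.setoid p)) (s := ascents p σ)
  unfold eulerDefect at heuler
  have hinj := Set.injOn_of_ncard_image_eq (f := Quotient.mk (SameCycle.setoid p))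
    (s := ascents p σ) (by omega)
  exact fun d hd d' hd' hdd' => hinj hd hd' (Quotient.sound hdd')

section Detach

variable [DecidableEq D] {p : Perm D} {c : D}

/-- The permutation obtained from `p` by cutting `c` out of its cycle, which makes `c` a fixed
point. -/
def detach (p : Perm D) (c : D) : Perm D :=
  swap c (p c) * p

/-- Replaces `c` by its predecessor, which stays on the cycle of `p` when `c` is detached. -/
def detachRetraction (p : Perm D) (c d : D) : D :=
  if d = c then p.symm c else d

theorem detachRetraction_of_ne {d : D} (h : d ≠ c) : detachRetraction p c d = d :=
  if_neg h

theorem detach_apply_eq_self {d : D} (h : d = c ∨ p d = d) : detach p c d = d := by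
  rcases eq_or_ne d c with rfl | hdc
  · exact swap_apply_right _ _
  · have hd : p d = d := h.resolve_left hdc
    rw [detach, Perm.mul_apply, hd]
    exact swap_apply_of_ne_of_ne hdc fun hdpc => hdc (p.injective (hd.trans hdpc))

theorem apply_detach {g : D → α} (hg : ∀ d, g (p d) = g d) (d : D) : g (detach p c d) = g d := by
  rw [detach, Perm.mul_apply, swap_apply_def]
  split_ifs with h₁ h₂
  · rw [hg, ← h₁, hg]
  · rw [← hg c, ← h₂, hg]
  · exact hg d

theorem detachRetraction_apply (hc : p c ≠ c) (d : D) : detachRetraction p c (p d) =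
    if p d = c then detachRetraction p c d else detach p c (detachRetraction p c d) := by
  split_ifs with hd
  · have hdc : d ≠ c := fun h => hc (h ▸ hd)
    rw [detachRetraction_of_ne hdc, detachRetraction, if_pos hd, ← hd, Equiv.symm_apply_apply]
  · rw [detachRetraction_of_ne hd, detach, Perm.mul_apply]
    rcases eq_or_ne d c with rfl | hdc
    · rw [detachRetraction, if_pos rfl, Equiv.apply_symm_apply, swap_apply_left]
    · rw [detachRetraction_of_ne hdc,
        swap_apply_of_ne_of_ne hd fun h => hdc (p.injective h)]

theorem sameCycle_detach_detachRetraction (hc : p c ≠ c) {x y : D} (h : p.SameCycle x y) :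
    (detach p c).SameCycle (detachRetraction p c x) (detachRetraction p c y) := by
  suffices SameCycle.setoid p ≤
      (SameCycle.setoid (detach p c)).comap (detachRetraction p c) from this h
  refine sameCycle_setoid_le_iff.2 fun d => ?_
  rw [Setoid.comap_rel, detachRetraction_apply hc]
  split_ifs
  · exact SameCycle.refl _ _
  · exact SameCycle.symm ⟨1, by simp⟩

theorem atMostOneAscent_comp_detachRetraction [Preorder α] {σ : D → α} (hc : p c ≠ c)
    (h : AtMostOneAscent (detach p c) σ) : AtMostOneAscent p (σ ∘ detachRetraction p c) := by
  have hascent : ∀ d ∈ ascents p (σ ∘ detachRetraction p c),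
      p d ≠ c ∧ detachRetraction p c d ∈ ascents (detach p c) σ := by
    intro d hd
    change σ (detachRetraction p c d) < σ (detachRetraction p c (p d)) at hd
    rw [detachRetraction_apply hc] at hd
    split_ifs at hd with hdc
    · exact absurd hd (lt_irrefl _)
    · exact ⟨hdc, hd⟩
  intro d hd d' hd' hdd'
  obtain ⟨hdc, hmem⟩ := hascent d hd
  obtain ⟨hdc', hmem'⟩ := hascent d' hd'
  have heq := h _ hmem _ hmem' (sameCycle_detach_detachRetraction hc hdd')
  have hsucc : ∀ {z}, p z ≠ c → p z = detach p c (detachRetraction p c z) := fun {z} hz => by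
    rw [← detachRetraction_of_ne (p := p) hz, detachRetraction_apply hc, if_neg hz]
  exact p.injective ((hsucc hdc).trans (heq ▸ (hsucc hdc').symm))

theorem eulerDefect_detach_le [Finite D] (q : Perm D) (hc : p c ≠ c) :
    eulerDefect (detach p c) q ≤ eulerDefect p q :=
  eulerDefect_swap_mul_le q hc.symm ⟨1, by simp⟩

theorem detach_induction [Finite D] {T : Set D} {motive : Perm D → Prop}
    (reduced : ∀ p, (∀ d ∉ T, p d = d) → motive p)
    (step : ∀ p, ∀ c ∉ T, p c ≠ c → motive (detach p c) → motive p) (p : Perm D) : motive p := by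
  induction hn : {d | d ∉ T ∧ p d ≠ d}.ncard using Nat.strong_induction_on generalizing p with
  | _ n ih =>
    by_cases hred : ∀ d ∉ T, p d = d
    · exact reduced p hred
    · push Not at hred
      obtain ⟨c, hcT, hc⟩ := hred
      refine step p c hcT hc (ih _ ?_ _ rfl)
      rw [← hn]
      refine Set.ncard_lt_ncard ((Set.ssubset_iff_of_subset ?_).2 ⟨c, ⟨hcT, hc⟩, ?_⟩)
      · exact fun d hd => ⟨hd.1, fun h => hd.2 (detach_apply_eq_self (.inr h))⟩
      · exact fun h => h.2 (detach_apply_eq_self (.inl rfl))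

end Detach

section CyclicList

variable {p : Perm D}

theorem exists_forall_ne_apply_le [LinearOrder α] {σ : D → α} (h : AtMostOneAscent p σ) (x : D) :
    ∃ u, p.SameCycle x u ∧ ∀ z, p.SameCycle x z → z ≠ u → σ (p z) ≤ σ z := by
  by_cases hx : ∃ u ∈ ascents p σ, p.SameCycle x u
  · obtain ⟨u, hu, hxu⟩ := hx
    exact ⟨u, hxu, fun z hz hzu => not_lt.1 fun hlt => hzu (h z hlt u hu (hz.symm.trans hxu))⟩
  · push Not at hx
    exact ⟨x, .refl _ _, fun z hz _ => not_lt.1 fun hlt => hx z hlt hz⟩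

theorem exists_append_of_pairwise_le {σ : D → Bool} {l : List D}
    (hl : l.Pairwise fun d d' => σ d' ≤ σ d) :
    ∃ l₁ l₂, l = l₁ ++ l₂ ∧ (∀ d ∈ l₁, σ d = true) ∧ ∀ d ∈ l₂, σ d = false := by
  induction hl with
  | nil => exact ⟨[], [], rfl, by simp⟩
  | @cons a l ha _ ih =>
    cases hσ : σ a with
    | false =>
      refine ⟨[], a :: l, rfl, by simp, List.forall_mem_cons.2 ⟨hσ, fun d hd => ?_⟩⟩
      exact Bool.eq_false_of_le_false (hσ ▸ ha d hd)
    | true =>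
      obtain ⟨l₁, l₂, rfl, h₁, h₂⟩ := ih
      exact ⟨a :: l₁, l₂, rfl, List.forall_mem_cons.2 ⟨hσ, h₁⟩, h₂⟩

theorem exists_list_split_of_atMostOneAscent [Finite D] {σ : D → Bool} (h : AtMostOneAscent p σ)
    (x : D) : ∃ l₁ l₂ : List D, (l₁ ++ l₂).Nodup ∧ (∀ d, d ∈ l₁ ++ l₂ ↔ p.SameCycle x d) ∧
      (l₁ ++ l₂).IsChain (fun d d' => d' = p d) ∧ (∀ d ∈ l₁, σ d = true) ∧
      ∀ d ∈ l₂, σ d = false := by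
  obtain ⟨u, hxu, hu⟩ := exists_forall_ne_apply_le h x
  have hxw : p.SameCycle x (p u) := hxu.trans ⟨1, by simp⟩
  let n := Function.minimalPeriod p (p u)
  let l := (List.range n).map fun i => p^[i] (p u)
  have hnodup : l.Nodup := Cycle.nodup_coe_iff.1 (Function.nodup_periodicOrbit (f := p))
  have hmem : ∀ d, d ∈ l ↔ p.SameCycle x d := fun d => by
    have hperiodic := p.injective.mem_periodicPts (p u)
    rw [← Cycle.mem_coe_iff]
    refine (Function.mem_periodicOrbit_iff hperiodic).trans ⟨?_, fun hd => ?_⟩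
    · rintro ⟨i, rfl⟩
      exact hxw.trans ⟨i, by rw [zpow_natCast, iterate_eq_pow]⟩
    · obtain ⟨i, rfl⟩ := (hxw.symm.trans hd).exists_nat_pow_eq
      exact ⟨i, by rw [iterate_eq_pow]⟩
  have hchain : l.IsChain fun d d' => d' = p d := by
    rw [List.isChain_map, List.isChain_range]
    exact fun i _ => Function.iterate_succ_apply' _ _ _
  have hantitone : l.IsChain fun d d' => σ d' ≤ σ d := by
    rw [List.isChain_map, List.isChain_range]
    intro i hi
    rw [Function.iterate_succ_apply']
    refine hu _ (hxw.trans ⟨i, by rw [zpow_natCast, iterate_eq_pow]⟩) fun hiu => ?_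
    have hperiod : p^[i + 1] (p u) = p u := by rw [Function.iterate_succ_apply', hiu]
    have := Function.IsPeriodicPt.minimalPeriod_le i.succ_pos hperiod
    omega
  have : IsTrans D fun d d' => σ d' ≤ σ d := ⟨fun _ _ _ h h' => h'.trans h⟩
  obtain ⟨l₁, l₂, hl, h₁, h₂⟩ :=
    exists_append_of_pairwise_le (List.isChain_iff_pairwise.1 hantitone)
  rw [hl] at hnodup hmem hchain
  exact ⟨l₁, l₂, hnodup, hmem, hchain, h₁, h₂⟩

end CyclicList

end Ascents

namespace FlowNetwork

variable {V E : Type*} {G : FlowNetwork V E}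

/-- The vertex `v` is given the number of arcs from which a path of positive arcs leads to `v`. -/
theorem IsAcyclic.exists_topologicalNumbering [Finite E] {f : E → ℝ} (h : G.IsAcyclic f) :
    ∃ π : V → ℕ, ∀ e, 0 < f e → π (G.tail e) < π (G.head e) := by
  let follows (a b : {e // 0 < f e}) : Prop := G.head a = G.tail b
  let ancestors (v : V) : Set {e // 0 < f e} :=
    {a | ∃ b : {e // 0 < f e}, G.head b = v ∧ Relation.ReflTransGen follows a b}
  refine ⟨fun v => (ancestors v).ncard, fun e he => Set.ncard_lt_ncard ?_⟩
  refine (Set.ssubset_iff_of_subset ?_).2 ⟨⟨e, he⟩, ⟨_, rfl, .refl⟩, ?_⟩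
  · rintro a ⟨b, hb, hab⟩
    exact ⟨⟨e, he⟩, rfl, hab.tail hb⟩
  · rintro ⟨b, hb, heb⟩
    obtain ⟨l, hl, hlast⟩ := List.exists_isChain_cons_of_relationReflTransGen heb
    refine h ⟨(⟨e, he⟩ :: l).map Subtype.val, ⟨(List.isChain_map _).2 hl, by simp, ?_⟩, ?_⟩
    · rw [List.getLast_map, hlast]
      exact hb
    · exact fun a ha => let ⟨a', _, ha'⟩ := List.mem_map.1 ha; ha' ▸ a'.2

section Rotations

open Equiv Equiv.Perm

variable {S : Set E} {p : Perm (E × Bool)} {π : V → ℕ}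

/-- `p` moves darts only around their vertices, and at every vertex the ends of the arcs in `S` lie
on one cycle of `p`. This holds for the rotation of an embedding, and it survives detaching ends of
arcs outside `S`. -/
structure IsRotationOn (G : FlowNetwork V E) (S : Set E) (p : Perm (E × Bool)) : Prop where
  dartVertex_apply : ∀ d, G.dartVertex (p d) = G.dartVertex d
  sameCycle : ∀ d d', d.1 ∈ S → d'.1 ∈ S → G.dartVertex d = G.dartVertex d' → p.SameCycle d d'

/-- Every vertex other than the source and the sink that has an incoming or an outgoing arc in `S`
has both. -/
def IsBalanced (G : FlowNetwork V E) (S : Set E) : Prop :=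
  ∀ d : E × Bool, d.1 ∈ S → G.dartVertex d ≠ G.source → G.dartVertex d ≠ G.sink →
    ∃ d' : E × Bool, d'.1 ∈ S ∧ G.dartVertex d' = G.dartVertex d ∧ d'.2 = !d.2

theorem IsRotationOn.detach [DecidableEq (E × Bool)] (hp : G.IsRotationOn S p) {c : E × Bool}
    (hcS : c.1 ∉ S) (hc : p c ≠ c) : G.IsRotationOn S (detach p c) where
  dartVertex_apply := apply_detach hp.dartVertex_apply
  sameCycle d d' hd hd' hdd' := by
    have hne : ∀ {d : E × Bool}, d.1 ∈ S → d ≠ c := fun hd hdc => hcS (hdc ▸ hd)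
    simpa only [detachRetraction_of_ne (hne hd), detachRetraction_of_ne (hne hd')] using
      sameCycle_detach_detachRetraction hc (hp.sameCycle d d' hd hd' hdd')

theorem fst_mem_of_forall_notMem_ascents [Finite E] (hfix : ∀ d : E × Bool, d.1 ∉ S → p d = d)
    {x : E × Bool}
    (hfree : ∀ z, (p * dartFlip E).SameCycle x z → z ∉ ascents (p * dartFlip E) Prod.snd) :
    x.1 ∈ S := by
  by_contra hx
  have hflip : (p * dartFlip E) x = dartFlip E x := hfix (dartFlip E x) hx
  have hlabel := eq_of_sameCycle_of_forall_notMem_ascents hfree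
    (sameCycle_apply_right.2 (.refl _ _))
  rw [hflip] at hlabel
  exact Bool.not_ne_self _ hlabel

/-- Along a face without an ascent all arcs would be traversed in the same direction, so that `π`
would be strictly monotone along it. -/
theorem IsRotationOn.exists_ascent_face [Finite E] (hp : G.IsRotationOn S p)
    (hfix : ∀ d : E × Bool, d.1 ∉ S → p d = d) (hπ : ∀ e ∈ S, π (G.tail e) < π (G.head e))
    (x : E × Bool) :
    ∃ y ∈ ascents (p * dartFlip E) Prod.snd, (p * dartFlip E).SameCycle x y := by
  by_contra! hno
  have hfree : ∀ z, (p * dartFlip E).SameCycle x z → z ∉ ascents (p * dartFlip E) Prod.snd :=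
    fun z hz hmem => hno z hmem hz
  have hlabel : ∀ z, (p * dartFlip E).SameCycle x z → z.2 = x.2 := fun z hz =>
    eq_of_sameCycle_of_forall_notMem_ascents hfree hz
  have hmem : ∀ z, (p * dartFlip E).SameCycle x z → z.1 ∈ S := fun z hz =>
    fst_mem_of_forall_notMem_ascents hfix fun y hy => hfree y (hz.trans hy)
  have hvertex : ∀ z, G.dartVertex ((p * dartFlip E) z) = G.dartVertex (z.1, !z.2) := fun z =>
    hp.dartVertex_apply _
  have hnext : (p * dartFlip E).SameCycle x ((p * dartFlip E) x) :=
    sameCycle_apply_right.2 (.refl _ _)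
  cases hx : x.2 with
  | false =>
    have hlt : ∀ z, (p * dartFlip E).SameCycle x z →
        π (G.dartVertex z) < π (G.dartVertex ((p * dartFlip E) z)) := fun z hz => by
      rw [hvertex]
      simpa [dartVertex, (hlabel z hz).trans hx] using hπ z.1 (hmem z hz)
    exact (hlt x (.refl _ _)).ne' <| eq_of_sameCycle_of_forall_le_apply
      (g := fun z => π (G.dartVertex z)) (fun z hz => (hlt z hz).le) hnext
  | true =>
    have hlt : ∀ z, (p * dartFlip E).SameCycle x z →
        π (G.dartVertex ((p * dartFlip E) z)) < π (G.dartVertex z) := fun z hz => by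
      rw [hvertex]
      simpa [dartVertex, (hlabel z hz).trans hx] using hπ z.1 (hmem z hz)
    exact (hlt x (.refl _ _)).ne <| eq_of_sameCycle_of_forall_le_apply (α := ℕᵒᵈ)
      (g := fun z => π (G.dartVertex z)) (fun z hz => (hlt z hz).le) hnext

theorem IsRotationOn.dartVertex_eq_of_forall_notMem_ascents [Finite E] (hp : G.IsRotationOn S p)
    (hS : G.IsBalanced S) {d : E × Bool} (hd : d.1 ∈ S)
    (hfree : ∀ z, p.SameCycle d z → z ∉ ascents p Prod.snd) :
    G.dartVertex d = if d.2 then G.sink else G.source := by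
  have hterminal : G.dartVertex d = G.source ∨ G.dartVertex d = G.sink := by
    by_contra! hne
    obtain ⟨d', hd', hvertex, hlabel⟩ := hS d hd hne.1 hne.2
    have hsame := eq_of_sameCycle_of_forall_notMem_ascents hfree
      (hp.sameCycle d d' hd hd' hvertex.symm)
    exact Bool.not_ne_self _ (hlabel.symm.trans hsame)
  obtain ⟨e, _ | _⟩ := d
  · exact hterminal.resolve_right (G.tail_ne_sink e)
  · exact hterminal.resolve_left (G.head_ne_source e)

theorem mem_and_mem_or_fst_eq_of_rel_sup (hfix : ∀ d : E × Bool, d.1 ∉ S → p d = d)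
    {x y : E × Bool} (h : (SameCycle.setoid p ⊔ SameCycle.setoid (dartFlip E)) x y) :
    x.1 ∈ S ∧ y.1 ∈ S ∨ x.1 = y.1 := by
  classical
  suffices SameCycle.setoid p ⊔ SameCycle.setoid (dartFlip E) ≤
      Setoid.ker fun d : E × Bool => if d.1 ∈ S then none else some d.1 by
    have hxy := this h
    rw [Setoid.ker_def] at hxy
    split_ifs at hxy with hx hy
    · exact .inl ⟨hx, hy⟩
    · exact .inr (Option.some.inj hxy)
  refine sup_le (sameCycle_setoid_le_iff.2 fun d => ?_) (sameCycle_setoid_le_iff.2 fun d => rfl)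
  rw [Setoid.ker_def]
  by_cases hd : d.1 ∈ S
  · have hpd : (p d).1 ∈ S := by
      by_contra hpd
      exact hpd ((p.injective (hfix _ hpd)).symm ▸ hd)
    rw [if_pos hd, if_pos hpd]
  · rw [hfix d hd]

theorem ncard_setOf_snd_eq_true [Finite E] : {d : E × Bool | d.2 = true}.ncard = Nat.card E := by
  have hprod : {d : E × Bool | d.2 = true} = Set.univ ×ˢ {true} := by
    ext
    simp
  rw [hprod, Set.ncard_prod, Set.ncard_univ, Set.ncard_singleton, mul_one]

theorem IsRotationOn.atMostOneAscent_of_forall_apply_eq [Finite E] (hp : G.IsRotationOn S p)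
    (hS : G.IsBalanced S) (hπ : ∀ e ∈ S, π (G.tail e) < π (G.head e))
    (hfix : ∀ d : E × Bool, d.1 ∉ S → p d = d)
    (heuler : eulerDefect p (dartFlip E) + Nat.card E ≤ 0) : AtMostOneAscent p Prod.snd := by
  refine atMostOneAscent_of_eulerDefect_add_ncard_nonpos (fun _ => rfl)
    (hp.exists_ascent_face hfix hπ) (fun x y hx hy hxy hrel => ?_)
    (by rwa [ncard_setOf_snd_eq_true])
  rcases mem_and_mem_or_fst_eq_of_rel_sup hfix hrel with ⟨hxS, hyS⟩ | hfst
  · refine hp.sameCycle x y hxS hyS ?_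
    rw [hp.dartVertex_eq_of_forall_notMem_ascents hS hxS hx,
      hp.dartVertex_eq_of_forall_notMem_ascents hS hyS hy, hxy]
  · exact Prod.ext hfst hxy ▸ .refl _ _

/-- The ends of the arcs outside `S` are detached one after another, and in the end each of them
gets the label of its predecessor. -/
theorem IsRotationOn.exists_labelling [Finite E] (hp : G.IsRotationOn S p)
    (hS : G.IsBalanced S) (hπ : ∀ e ∈ S, π (G.tail e) < π (G.head e))
    (heuler : eulerDefect p (dartFlip E) + Nat.card E ≤ 0) :
    ∃ σ : E × Bool → Bool, (∀ d, d.1 ∈ S → σ d = d.2) ∧ AtMostOneAscent p σ := by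
  classical
  induction p using detach_induction (T := {d : E × Bool | d.1 ∈ S}) with
  | reduced p hfix =>
    exact ⟨Prod.snd, fun _ _ => rfl, hp.atMostOneAscent_of_forall_apply_eq hS hπ hfix heuler⟩
  | step p c hcS hc ih =>
    obtain ⟨σ, hσ, hascent⟩ := ih (hp.detach hcS hc)
      (by linarith [eulerDefect_detach_le (dartFlip E) hc])
    refine ⟨σ ∘ detachRetraction p c, fun d hd => ?_,
      atMostOneAscent_comp_detachRetraction hc hascent⟩
    rw [Function.comp_apply, detachRetraction_of_ne fun hdc : d = c => hcS (hdc ▸ hd)]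
    exact hσ d hd

end Rotations

section DartFlow

variable [Fintype E] {f : E → ℝ}

theorem inflow_pos_iff (hf : ∀ e, 0 ≤ f e) {v : V} :
    0 < G.inflow f v ↔ ∃ e, G.head e = v ∧ 0 < f e := by
  simp [inflow, Finset.sum_pos_iff_of_nonneg fun e _ => hf e]

theorem outflow_pos_iff (hf : ∀ e, 0 ≤ f e) {v : V} :
    0 < G.outflow f v ↔ ∃ e, G.tail e = v ∧ 0 < f e := by
  simp [outflow, Finset.sum_pos_iff_of_nonneg fun e _ => hf e]

theorem isBalanced_setOf_pos (hf : ∀ e, 0 ≤ f e)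
    (hcons : ∀ v, v ≠ G.source → v ≠ G.sink → G.inflow f v = G.outflow f v) :
    G.IsBalanced {e | 0 < f e} := by
  rintro ⟨e, _ | _⟩ he hs ht
  · obtain ⟨e', hv, he'⟩ := (inflow_pos_iff hf).1 <|
      (hcons _ hs ht).symm ▸ (outflow_pos_iff hf).2 ⟨e, rfl, he⟩
    exact ⟨(e', true), he', hv, rfl⟩
  · obtain ⟨e', hv, he'⟩ := (outflow_pos_iff hf).1 <|
      hcons _ hs ht ▸ (inflow_pos_iff hf).2 ⟨e, rfl, he⟩
    exact ⟨(e', false), he', hv, rfl⟩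

/-- The net amount that `f` carries along the arc of the dart `d` into the vertex of `d`. -/
def dartFlow (f : E → ℝ) (d : E × Bool) : ℝ :=
  if d.2 then f d.1 else -f d.1

open Classical in
theorem inflow_sub_outflow (G : FlowNetwork V E) (f : E → ℝ) (v : V) :
    G.inflow f v - G.outflow f v = ∑ d, if G.dartVertex d = v then dartFlow f d else 0 := by
  rw [inflow, outflow, Finset.sum_filter, Finset.sum_filter, Fintype.sum_prod_type_right,
    Fintype.sum_bool, sub_eq_add_neg, ← Finset.sum_neg_distrib]
  simp only [dartVertex, dartFlow, if_true, Bool.false_eq_true, if_false, neg_ite, neg_zero]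

theorem inflow_eq_sum_map_dartFlow {l : List (E × Bool)} {v : V} (hl : l.Nodup)
    (hvertex : ∀ d ∈ l, G.dartVertex d = v) (hin : ∀ e, G.head e = v → f e ≠ 0 → (e, true) ∈ l)
    (hout : ∀ e, (e, false) ∈ l → f e = 0) : G.inflow f v = (l.map (dartFlow f)).sum := by
  classical
  have hmem : l.toFinset = Finset.univ.filter (· ∈ l) := by
    ext
    simp
  rw [← List.sum_toFinset _ hl, hmem, Finset.sum_filter, Fintype.sum_prod_type_right,
    Fintype.sum_bool, ← Finset.sum_add_distrib, inflow, Finset.sum_filter]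
  refine Finset.sum_congr rfl fun e _ => ?_
  by_cases he : f e = 0
  · simp [dartFlow, he]
  · have hhead : (e, true) ∈ l ↔ G.head e = v := ⟨hvertex (e, true), fun hv => hin e hv he⟩
    have htail : (e, false) ∉ l := fun h => he (hout e h)
    simp [dartFlow, hhead, htail]

end DartFlow

end FlowNetwork

theorem sum_map_eq_sub_of_isChain {D M : Type*} [AddCommGroup M] {s g : D → M} {a : D} {l : List D}
    (h : (a :: l).IsChain fun x y => s y = g y - g x) :
    (l.map s).sum = g ((a :: l).getLast (List.cons_ne_nil a l)) - g a := by
  induction l generalizing a with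
  | nil => simp
  | cons b l ih =>
    obtain ⟨hab, hl⟩ := List.isChain_cons_cons.1 h
    rw [List.map_cons, List.sum_cons, ih hl, hab, List.getLast_cons (List.cons_ne_nil b l)]
    abel

namespace PlanarEmbedding

open FlowNetwork

variable {V E : Type*} {G : FlowNetwork V E}

open Classical in
/-- The net clockwise flow on the edge of the extended graph that joins the dart `d` at a vertex of
finite capacity to the clockwise next dart; the value at the remaining darts is junk. -/
noncomputable def ringFlow (f : ExtArc G → ℝ) (d : E × Bool) : ℝ :=
  if h : G.vertexCap (G.dartVertex d) ≠ ⊤ then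
    f (Sum.inr (⟨d, h⟩, false)) - f (Sum.inr (⟨d, h⟩, true))
  else 0

theorem ringFlow_coe (f : ExtArc G → ℝ) (c : CapDart G) :
    ringFlow f c = f (Sum.inr (c, false)) - f (Sum.inr (c, true)) :=
  dif_pos c.2

theorem attach_eq_inl_iff {d : E × Bool} {v : {v : V // G.vertexCap v = ⊤}} :
    attach G d = Sum.inl v ↔ G.dartVertex d = v := by
  refine ⟨attach_eq_inl, fun h => ?_⟩
  obtain ⟨v, hv⟩ := v
  subst h
  exact dif_pos hv

theorem attach_eq_inr_iff {d : E × Bool} {c : CapDart G} : attach G d = Sum.inr c ↔ d = c := by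
  constructor
  · unfold attach
    split <;> intro h
    · cases h
    · exact congrArg Subtype.val (Sum.inr.inj h)
  · rintro rfl
    exact dif_neg c.2

variable [Fintype E]

section Consecutive

variable {f : E → ℝ}

theorem isRotationOn (emb : PlanarEmbedding G) (S : Set E) : G.IsRotationOn S emb.rot where
  dartVertex_apply := emb.dartVertex_rot
  sameCycle d d' _ _ h := (emb.sameCycle_iff d d').2 h

theorem eulerDefect_add_card (emb : PlanarEmbedding G) :
    eulerDefect emb.rot (dartFlip E) + Nat.card E = 0 := by
  have heuler := emb.euler
  rw [← numOrbits, ← Nat.card_eq_fintype_card] at heuler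
  unfold eulerDefect
  omega

theorem consecutiveAt_of_atMostOneAscent (emb : PlanarEmbedding G) {σ : E × Bool → Bool}
    (hσ : ∀ d, 0 < f d.1 → σ d = d.2) (hascent : AtMostOneAscent emb.rot σ) (v : V) :
    emb.ConsecutiveAt f v := by
  by_cases hv : ∃ d, G.dartVertex d = v
  · obtain ⟨d, rfl⟩ := hv
    obtain ⟨l₁, l₂, hnodup, hmem, hchain, h₁, h₂⟩ := exists_list_split_of_atMostOneAscent hascent d
    have hvertex : ∀ x, x ∈ l₁ ++ l₂ ↔ G.dartVertex x = G.dartVertex d := fun x =>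
      (hmem x).trans ((emb.sameCycle_iff d x).trans eq_comm)
    refine ⟨l₁, l₂, hnodup, hvertex, hchain, fun e he hpos => ?_, fun e he hpos => ?_⟩
    · refine (List.mem_append.1 ((hvertex (e, true)).2 he)).resolve_right fun h => ?_
      exact Bool.noConfusion ((hσ _ hpos).symm.trans (h₂ _ h))
    · refine (List.mem_append.1 ((hvertex (e, false)).2 he)).resolve_left fun h => ?_
      exact Bool.noConfusion ((hσ _ hpos).symm.trans (h₁ _ h))
  · push Not at hv
    exact ⟨[], [], List.nodup_nil, fun d => by simp [hv d], List.isChain_nil,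
      fun e he => absurd he (hv (e, true)), fun e he => absurd he (hv (e, false))⟩

theorem consecutiveAt_of_isAcyclic (emb : PlanarEmbedding G) (hnonneg : ∀ e, 0 ≤ f e)
    (hcons : ∀ v, v ≠ G.source → v ≠ G.sink → G.inflow f v = G.outflow f v)
    (hacyc : G.IsAcyclic f) (v : V) : emb.ConsecutiveAt f v := by
  obtain ⟨π, hπ⟩ := hacyc.exists_topologicalNumbering
  obtain ⟨σ, hσ, hascent⟩ := (emb.isRotationOn {e | 0 < f e}).exists_labelling
    (isBalanced_setOf_pos hnonneg hcons) hπ emb.eulerDefect_add_card.le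
  exact emb.consecutiveAt_of_atMostOneAscent hσ hascent v

end Consecutive

section Extended

variable {f : ExtArc G → ℝ}

theorem next_injective (emb : PlanarEmbedding G) : Function.Injective emb.next :=
  fun _ _ h => Subtype.ext (emb.rot.injective (congrArg Subtype.val h))

open Classical in
theorem extended_inflow_sub_outflow (emb : PlanarEmbedding G) (f : ExtArc G → ℝ)
    (w : ExtVertex G) : emb.extended.inflow f w - emb.extended.outflow f w =
      (∑ d, if attach G d = w then dartFlow (restrict f) d else 0) +
        ∑ c : CapDart G, ((if Sum.inr (emb.next c) = w then ringFlow f c else 0) -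
          if Sum.inr c = w then ringFlow f c else 0) := by
  rw [inflow, outflow, Finset.sum_filter, Finset.sum_filter, Fintype.sum_sum_type,
    Fintype.sum_sum_type, add_sub_add_comm]
  congr 1
  · rw [Fintype.sum_prod_type_right, Fintype.sum_bool, sub_eq_add_neg, ← Finset.sum_neg_distrib]
    refine congrArg₂ (· + ·) (Finset.sum_congr rfl fun e _ => ?_)
      (Finset.sum_congr rfl fun e _ => ?_)
    · by_cases h : attach G (e, true) = w <;> simp [extended, dartFlow, restrict, h]
    · by_cases h : attach G (e, false) = w <;> simp [extended, dartFlow, restrict, h]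
  · rw [Fintype.sum_prod_type, Fintype.sum_prod_type, ← Finset.sum_sub_distrib]
    refine Finset.sum_congr rfl fun c _ => ?_
    by_cases hc : Sum.inr c = w <;> by_cases hnext : Sum.inr (emb.next c) = w <;>
      simp [extended, ringFlow_coe, hc, hnext]

theorem dartFlow_rot (emb : PlanarEmbedding G) (hf : emb.extended.IsFlow f) {d : E × Bool}
    (hd : G.vertexCap (G.dartVertex d) ≠ ⊤) :
    dartFlow (restrict f) (emb.rot d) = ringFlow f (emb.rot d) - ringFlow f d := by
  classical
  let c : CapDart G := ⟨d, hd⟩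
  have hcons := hf.conservation (Sum.inr (emb.next c)) Sum.inr_ne_inl Sum.inr_ne_inl
  rw [← sub_eq_zero, extended_inflow_sub_outflow, Finset.sum_sub_distrib] at hcons
  simp only [attach_eq_inr_iff, Sum.inr.injEq, emb.next_injective.eq_iff, Finset.sum_ite_eq',
    Finset.mem_univ, if_true] at hcons
  change dartFlow (restrict f) (emb.rot d) + (ringFlow f d - ringFlow f (emb.rot d)) = 0 at hcons
  linarith

theorem inflow_restrict_eq_outflow_restrict (emb : PlanarEmbedding G) (hf : emb.extended.IsFlow f)
    {v : V} (hs : v ≠ G.source) (ht : v ≠ G.sink) :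
    G.inflow (restrict f) v = G.outflow (restrict f) v := by
  classical
  rw [← sub_eq_zero, inflow_sub_outflow]
  by_cases hv : G.vertexCap v = ⊤
  · have hcons := hf.conservation (Sum.inl ⟨v, hv⟩)
      (fun h => hs (congrArg Subtype.val (Sum.inl.inj h)))
      (fun h => ht (congrArg Subtype.val (Sum.inl.inj h)))
    rw [← sub_eq_zero, extended_inflow_sub_outflow] at hcons
    simpa only [attach_eq_inl_iff, reduceCtorEq, if_false, sub_zero, Finset.sum_const_zero,
      add_zero] using hcons
  · have hreindex : ∀ g : E × Bool → ℝ, (∑ d, if G.dartVertex d = v then g (emb.rot d) else 0) =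
        ∑ d, if G.dartVertex d = v then g d else 0 := fun g => by
      rw [← Equiv.sum_comp emb.rot fun d => if G.dartVertex d = v then g d else 0]
      simp only [emb.dartVertex_rot]
    have htelescope : ∀ d, (if G.dartVertex d = v then dartFlow (restrict f) (emb.rot d) else 0) =
        (if G.dartVertex d = v then ringFlow f (emb.rot d) else 0) -
          if G.dartVertex d = v then ringFlow f d else 0 := fun d => by
      split_ifs with hd
      · exact emb.dartFlow_rot hf (hd ▸ hv)
      · rw [sub_zero]
    rw [← hreindex, Finset.sum_congr rfl fun d _ => htelescope d, Finset.sum_sub_distrib, hreindex,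
      sub_self]

theorem abs_ringFlow_le (emb : PlanarEmbedding G) (hf : emb.extended.IsFlow f) {d : E × Bool}
    (hd : G.vertexCap (G.dartVertex d) ≠ ⊤) :
    |ringFlow f d| ≤ (G.vertexCap (G.dartVertex d)).toReal / 2 := by
  have hnonneg := fun b => hf.nonneg (Sum.inr (⟨d, hd⟩, b))
  have hle : ∀ b, f (Sum.inr (⟨d, hd⟩, b)) ≤ (G.vertexCap (G.dartVertex d)).toReal / 2 := by
    intro b
    have hcap : ENNReal.ofReal (f (Sum.inr (⟨d, hd⟩, b))) ≤ G.vertexCap (G.dartVertex d) / 2 :=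
      hf.le_arcCap (Sum.inr (⟨d, hd⟩, b))
    rwa [ENNReal.ofReal_le_iff_le_toReal (ENNReal.div_ne_top hd two_ne_zero), ENNReal.toReal_div,
      ENNReal.toReal_ofNat] at hcap
  rw [ringFlow_coe f ⟨d, hd⟩, abs_le]
  constructor <;> linarith [hle true, hle false, hnonneg true, hnonneg false]

/-- The flow into a block of consecutive darts leaves the block along the two ring edges at its
ends. -/
theorem sum_map_dartFlow_le (emb : PlanarEmbedding G) (hf : emb.extended.IsFlow f) {v : V}
    (hv : G.vertexCap v ≠ ⊤) {l : List (E × Bool)} (hvertex : ∀ d ∈ l, G.dartVertex d = v)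
    (hchain : l.IsChain fun d d' => d' = emb.rot d) :
    (l.map (dartFlow (restrict f))).sum ≤ (G.vertexCap v).toReal := by
  rcases l with _ | ⟨a, l⟩
  · simp
  · obtain ⟨b, rfl⟩ := emb.rot.surjective a
    have hat : ∀ d ∈ b :: emb.rot b :: l, G.dartVertex d = v := List.forall_mem_cons.2
      ⟨(emb.dartVertex_rot b).symm.trans (hvertex _ List.mem_cons_self), hvertex⟩
    have hbound : ∀ d ∈ b :: emb.rot b :: l, |ringFlow f d| ≤ (G.vertexCap v).toReal / 2 :=
      fun d hd => hat d hd ▸ emb.abs_ringFlow_le hf ((hat d hd).symm ▸ hv)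
    have htelescope : (b :: emb.rot b :: l).IsChain fun d d' =>
        dartFlow (restrict f) d' = ringFlow f d' - ringFlow f d := by
      have hchain' : (b :: emb.rot b :: l).IsChain fun d d' => d' = emb.rot d :=
        List.isChain_cons_cons.2 ⟨rfl, hchain⟩
      refine hchain'.imp_of_mem_imp fun d d' hd _ hdd' => ?_
      subst hdd'
      exact emb.dartFlow_rot hf ((hat d hd).symm ▸ hv)
    rw [sum_map_eq_sub_of_isChain htelescope]
    linarith [(abs_le.1 (hbound _ (List.getLast_mem (List.cons_ne_nil b _)))).2,
      (abs_le.1 (hbound b List.mem_cons_self)).1]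

theorem inflow_restrict_le (emb : PlanarEmbedding G) (hf : emb.extended.IsFlow f) {v : V}
    (hv : G.vertexCap v ≠ ⊤) (hcon : emb.ConsecutiveAt (restrict f) v) :
    G.inflow (restrict f) v ≤ (G.vertexCap v).toReal := by
  obtain ⟨l₁, l₂, hnodup, hmem, hchain, hin, hout⟩ := hcon
  have hvertex : ∀ d ∈ l₁, G.dartVertex d = v := fun d hd =>
    (hmem d).1 (List.mem_append_left l₂ hd)
  have hpos : ∀ e, restrict f e ≠ 0 → 0 < restrict f e := fun e he =>
    (hf.nonneg (Sum.inl e)).lt_of_ne' he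
  rw [inflow_eq_sum_map_dartFlow hnodup.of_append_left hvertex (fun e he h => hin e he (hpos e h))]
  · exact emb.sum_map_dartFlow_le hf hv hvertex hchain.left_of_append
  · intro e he
    by_contra h
    exact List.disjoint_of_nodup_append hnodup he (hout e (hvertex _ he) (hpos e h))

end Extended

end PlanarEmbedding

theorem mainTheorem2_general {V E : Type*} [Fintype E] (G : FlowNetwork V E)
    (emb : PlanarEmbedding G) (f : PlanarEmbedding.ExtArc G → ℝ)
    (hf : emb.extended.IsFlow f) (hacyc : G.IsAcyclic (PlanarEmbedding.restrict f)) :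
    G.IsFlow (PlanarEmbedding.restrict f) ∧
      ∀ v, emb.ConsecutiveAt (PlanarEmbedding.restrict f) v := by
  have hnonneg : ∀ e, 0 ≤ PlanarEmbedding.restrict f e := fun e => hf.nonneg (Sum.inl e)
  have hcons : ∀ v, v ≠ G.source → v ≠ G.sink → G.inflow (PlanarEmbedding.restrict f) v =
      G.outflow (PlanarEmbedding.restrict f) v :=
    fun _ => emb.inflow_restrict_eq_outflow_restrict hf
  have hconsecutive := emb.consecutiveAt_of_isAcyclic hnonneg hcons hacyc
  refine ⟨⟨hnonneg, fun e => hf.le_arcCap (Sum.inl e), fun v _ _ => ?_, hcons⟩, hconsecutive⟩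
  by_cases hv : G.vertexCap v = ⊤
  · exact hv ▸ le_top
  · exact (ENNReal.ofReal_le_iff_le_toReal hv).2 (emb.inflow_restrict_le hf hv (hconsecutive v))

theorem mainTheorem2 {V E : Type*} [Finite V] [Fintype E] (G : FlowNetwork V E)
    (hG : G.IsSimple) (emb : PlanarEmbedding G) (f : PlanarEmbedding.ExtArc G → ℝ)
    (hf : emb.extended.IsFlow f) (hacyc : G.IsAcyclic (PlanarEmbedding.restrict f)) :
    G.IsFlow (PlanarEmbedding.restrict f) ∧
      ∀ v, emb.ConsecutiveAt (PlanarEmbedding.restrict f) v :=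
  mainTheorem2_general G emb f hf hacyc
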